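/- Consider a two-player game in which each player has the actions $\{1,\dots,m\}$. All $2m^2$ payoffs $U_i(a)$, for $i\in\{1,2\}$ and $a\in\{1,\dots,m\}^2$, are drawn independently from one atomless probability distribution $\mathbb{P}$ on $\mathbb{R}$, so that almost surely each player has a unique best response to each action of the other. An initial profile $A^0$ is drawn uniformly from $\{1,\dots,m\}^2$, independently of the payoffs. In the clockwork best-response dynamic the players move alternately, player 1 at times $t=1,3,5,\dots$ and player 2 at times $t=2,4,6,\dots$; at each time $t\ge 1$ the moving player switches to her best response to the other player's current action, which gives the next profile $A^t$. For $k\ge 1$ the dynamic is said to converge to a $2k$-cycle if there is a time $t\ge 1$ such that from $t$ onwards the block of (possibly non-distinct) profiles $A^t,\dots,A^{t+2k-1}$ repeats itself forever, $k$ is the smallest positive integer with this property, and $t$ is the first time $\ge 1$ at which the profile $A^t$ is visited. It converges to a pure Nash equilibrium if $A^t$ is a pure Nash equilibrium for some $t\ge 1$. Write $f(m)\sim g(m)$ if $f(m)/g(m)\to 1$ as $m\to\infty$, and let $\Phi(x)=\frac1{\sqrt{2\pi}}\int_{-\infty}^x e^{-z^2/2}\,dz$. Let $k=k(m)\ge 1$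 be integers. (1) If $k=o(m^{2/3})$ then, as $m\to\infty$, $$\Pr[\text{the dynamic converges to a } 2k\text{-cycle}]\;\sim\;2\sqrt{\frac{\pi}{m}}\left(1-\Phi\!\left(\frac{2k-1}{\sqrt{2m}}\right)\right).$$ (2) If $k=o(\sqrt m)$ then, as $m\to\infty$, $$\Pr[\text{the dynamic converges to a } 2k\text{-cycle}]\;\sim\;\sqrt{\frac{\pi}{m}}.$$ (3) In particular, $\Pr[\text{the dynamic converges to a pure Nash equilibrium}]\sim\sqrt{\pi/m}$. -/

import Mathlib

open MeasureTheory ProbabilityTheory Filter Topology Asymptotics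

namespace BestResponse

/-- Action profiles of an `n`-player game in which player `i` has `m i` actions. -/
abbrev Profile {n : ℕ} (m : Fin n → ℕ) : Type := (i : Fin n) → Fin (m i)

/-- A game, given by its payoff functions `u i : Profile m → ℝ`. -/
abbrev Game {n : ℕ} (m : Fin n → ℕ) : Type := Fin n → Profile m → ℝ

/-- The best responses of player `i` to the environment consisting of the actions that the
other players take in `a` (the entry `a i` plays no role). -/
def bestResponses {n : ℕ} {m : Fin n → ℕ} (u : Game m) (i : Fin n) (a : Profile m) :
    Set (Fin (m i)) :=
  {x | ∀ y : Fin (m i), u i (Function.update a i y) ≤ u i (Function.update a i x)}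

/-- Every player has exactly one best response to each environment. -/
def UniqueBestResponses {n : ℕ} {m : Fin n → ℕ} (u : Game m) : Prop :=
  ∀ (i : Fin n) (a : Profile m), ∃! x : Fin (m i), x ∈ bestResponses u i a

/-- `a` is a pure Nash equilibrium of the game `u`. -/
def IsPureNash {n : ℕ} {m : Fin n → ℕ} (u : Game m) (a : Profile m) : Prop :=
  ∀ (i : Fin n) (y : Fin (m i)), u i (Function.update a i y) ≤ u i a

/-- The clockwork playing sequence: with players numbered from `0`, the player moving at time
`t ≥ 1` is `(t - 1) mod n`. -/
def clockwork (n : ℕ) [NeZero n] (t : ℕ) : Fin n := Fin.ofNat n (t - 1)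

/-- `a` is a path of the best-response dynamic on the game `u` with playing sequence `s`, started
at `a₀`: at each time `t + 1 ≥ 1` player `s (t + 1)` switches to a best response to the current
environment and nobody else moves. If best responses are unique, there is exactly one such path. -/
def IsBestResponsePath {n : ℕ} {m : Fin n → ℕ} (u : Game m) (s : ℕ → Fin n) (a₀ : Profile m)
    (a : ℕ → Profile m) : Prop :=
  a 0 = a₀ ∧ ∀ t : ℕ, ∃ x ∈ bestResponses u (s (t + 1)) (a t),
    a (t + 1) = Function.update (a t) (s (t + 1)) x

/-- From time `t` onwards the block `a t, …, a (t + 2 * k - 1)` repeats itself forever. -/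
def RepeatsFrom {α : Type*} (a : ℕ → α) (k t : ℕ) : Prop :=
  ∀ r : ℕ, t ≤ r → a (r + 2 * k) = a r

/-- The path `a` converges to a `2k`-cycle at time `t`: the block `a t, …, a (t + 2 * k - 1)`
repeats itself forever, no shorter block `a t, …, a (t + 2 * j - 1)` does, and `t` is the
hitting time (first time `≥ 1`) of the profile `a t`. -/
def ConvergesToCycleAt {α : Type*} (a : ℕ → α) (k t : ℕ) : Prop :=
  1 ≤ k ∧ RepeatsFrom a k t ∧ (∀ j : ℕ, 1 ≤ j → j < k → ¬ RepeatsFrom a j t) ∧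
    IsLeast {r : ℕ | 1 ≤ r ∧ a r = a t} t

/-- The path `a` converges to a `2k`-cycle (at some time). -/
def ConvergesToCycle {α : Type*} (a : ℕ → α) (k : ℕ) : Prop :=
  ∃ t : ℕ, ConvergesToCycleAt a k t

/-- The path `a` in the game `u` converges to a pure Nash equilibrium: it hits one at some finite
time `t ≥ 1`. -/
def ConvergesToPureNash {n : ℕ} {m : Fin n → ℕ} (u : Game m) (a : ℕ → Profile m) : Prop :=
  ∃ t : ℕ, 1 ≤ t ∧ IsPureNash u (a t)

/-- The law of a random game together with a random initial profile: all the payoffs are drawn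
independently from `P`, and the initial profile is drawn uniformly, independently of the game. -/
noncomputable def randomGame {n : ℕ} (P : Measure ℝ) (m : Fin n → ℕ) :
    Measure (Game m × Profile m) :=
  (Measure.pi fun _ : Fin n => Measure.pi fun _ : Profile m => P).prod
    (uniformOn (Set.univ : Set (Profile m)))

/-- The probability that the clockwork best-response dynamic on the random 2-player game with `m`
actions per player converges to a `2k`-cycle. -/
noncomputable def probCycle (P : Measure ℝ) (m k : ℕ) : ℝ :=
  (randomGame P fun _ : Fin 2 => m).real
    {ω | UniqueBestResponses ω.1 ∧
      ∃ a, IsBestResponsePath ω.1 (clockwork 2) ω.2 a ∧ ConvergesToCycle a k}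

/-- The probability that the clockwork best-response dynamic on the random 2-player game with `m`
actions per player converges to a pure Nash equilibrium. -/
noncomputable def probPureNash (P : Measure ℝ) (m : ℕ) : ℝ :=
  (randomGame P fun _ : Fin 2 => m).real
    {ω | UniqueBestResponses ω.1 ∧
      ∃ a, IsBestResponsePath ω.1 (clockwork 2) ω.2 a ∧ ConvergesToPureNash ω.1 a}

/-- The standard normal cumulative distribution function. -/
noncomputable def stdNormalCDF (x : ℝ) : ℝ := cdf (gaussianReal 0 1) x

end BestResponse

/-! Almost surely there are no payoff ties, and permuting a player's actions within each environment
preserves the law of the payoffs. So the best-response function `b` is uniform among all `m ^ (2 *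
m)` maps (`payoffLaw_isResponse`). The dynamic becomes a walk on the `2 * m` states (player to move,
action responded to); each profile from time 1 on encodes a state of the walk and its successor.

As long as the walk meets new states, its responses are independent and uniform: a birthday problem
with two alternating classes. State `r` has `⌊r/2⌋` predecessors belonging to the same player, so
the first `t` states are distinct with probability `freshProb m t = ∏_{r<t} (1 - ⌊r/2⌋/m)`. A
`2k`-cycle occurs exactly when the first repeated state is the one `2k` steps back, which has
conditional probability `1/m`. Summing over the starting time of the cycle gives the exact formula
`probCycle_eq`.

Up to parity `∑_{r<t} ⌊r/2⌋` is `(t-1)²/4`, so `freshProb m t ≈ exp(-(t-1)²/(4m))`; the second-order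
error in the exponent is at most `T³/m²` for `t ≤ T`, negligible when `T = o(m^{2/3})`. Comparing
the sum with an integral gives the tail beyond `2k-1` of a Gaussian of variance `2m`
(`tendsto_sum_freshProb_div_gaussianTail`). If `k = o(√m)`, this tail differs negligibly from the
half-line integral `√(πm)`. Convergence to a pure Nash equilibrium is the case `k = 1`. -/

namespace BestResponse

/-! ### Birthday problem for the alternating walk of a uniform response function -/

section Walk

variable {m : ℕ}

/-- The alternating walk driven by the response function `b`, started at action `y` of player `1`:
the state at time `t` is the player about to move together with the action she responds to. -/
def walkState (b : Fin 2 × Fin m → Fin m) (y : Fin m) : ℕ → Fin 2 × Fin m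
  | 0 => (0, y)
  | t + 1 => (Fin.ofNat 2 (t + 1), b (walkState b y t))

theorem walkState_fst (b : Fin 2 × Fin m → Fin m) (y : Fin m) (t : ℕ) :
    (walkState b y t).1 = Fin.ofNat 2 t := by
  cases t <;> rfl

theorem walkState_succ_snd (b : Fin 2 × Fin m → Fin m) (y : Fin m) (t : ℕ) :
    (walkState b y (t + 1)).2 = b (walkState b y t) := rfl

theorem ofNat_two_eq_iff (r s : ℕ) : Fin.ofNat 2 r = Fin.ofNat 2 s ↔ r % 2 = s % 2 := by
  simp [Fin.ext_iff]

theorem walkState_eq_iff (b b' : Fin 2 × Fin m → Fin m) (y y' : Fin m) (r s : ℕ) :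
    walkState b y r = walkState b' y' s ↔
      r % 2 = s % 2 ∧ (walkState b y r).2 = (walkState b' y' s).2 := by
  rw [Prod.ext_iff, walkState_fst, walkState_fst, ofNat_two_eq_iff]

/-- The walk up to time `n` only depends on the responses at the states visited before. -/
theorem walkState_congr {b b' : Fin 2 × Fin m → Fin m} {y : Fin m} {n : ℕ}
    (h : ∀ r < n, b' (walkState b y r) = b (walkState b y r)) :
    ∀ r ≤ n, walkState b' y r = walkState b y r := by
  intro r
  induction r with
  | zero => intro _; rfl
  | succ r ih =>
    intro hr
    simp only [walkState]
    rw [ih (by omega), h r (by omega)]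

/-- Two equal states of the walk at an even distance remain equal forever. -/
theorem walkState_periodic {b : Fin 2 × Fin m → Fin m} {y : Fin m} {s k : ℕ}
    (h : walkState b y (s + 2 * k) = walkState b y s) :
    ∀ r, s ≤ r → walkState b y (r + 2 * k) = walkState b y r := by
  intro r hr
  induction r, hr using Nat.le_induction with
  | base => exact h
  | succ r hr ih =>
    rw [walkState_eq_iff]
    refine ⟨by omega, ?_⟩
    rw [show r + 1 + 2 * k = r + 2 * k + 1 by ring, walkState_succ_snd, walkState_succ_snd, ih]

open Classical in
/-- The response functions along which the first `t` states of the walk are distinct. -/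
noncomputable def distinctWalks (y : Fin m) (t : ℕ) : Finset (Fin 2 × Fin m → Fin m) :=
  Finset.univ.filter fun b => Set.InjOn (walkState b y) (Set.Iio t)

theorem mem_distinctWalks {y : Fin m} {t : ℕ} {b : Fin 2 × Fin m → Fin m} :
    b ∈ distinctWalks y t ↔ Set.InjOn (walkState b y) (Set.Iio t) := by
  simp [distinctWalks]

/-- State `t` is new, so its response has not been consulted before and can be resampled without
altering the walk up to time `t`. -/
theorem walkState_update {y : Fin m} {t : ℕ} {b : Fin 2 × Fin m → Fin m}
    (hb : b ∈ distinctWalks y (t + 1)) (c : Fin m) :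
    ∀ r ≤ t, walkState (Function.update b (walkState b y t) c) y r = walkState b y r := by
  apply walkState_congr
  intro r hr
  rw [Function.update_of_ne]
  intro h
  have := mem_distinctWalks.1 hb (Set.mem_Iio.2 (by omega)) (Set.mem_Iio.2 (by omega)) h
  omega

theorem update_mem_distinctWalks {y : Fin m} {t : ℕ} {b : Fin 2 × Fin m → Fin m}
    (hb : b ∈ distinctWalks y (t + 1)) (c : Fin m) :
    Function.update b (walkState b y t) c ∈ distinctWalks y (t + 1) := by
  rw [mem_distinctWalks]
  intro r hr s hs h
  have hr' : r ≤ t := Nat.lt_succ_iff.1 hr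
  have hs' : s ≤ t := Nat.lt_succ_iff.1 hs
  rw [walkState_update hb c r hr', walkState_update hb c s hs'] at h
  exact mem_distinctWalks.1 hb hr hs h

open Classical in
/-- The response at a fresh state is uniform: it takes any value determined by the past of the walk
on a fraction `1 / m` of the response functions. -/
theorem card_response_eq (y : Fin m) (t : ℕ) (v : (Fin 2 × Fin m → Fin m) → Fin m)
    (hv : ∀ b ∈ distinctWalks y (t + 1), ∀ c,
      v (Function.update b (walkState b y t) c) = v b) :
    m * ((distinctWalks y (t + 1)).filter fun b => b (walkState b y t) = v b).card =
      (distinctWalks y (t + 1)).card := by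
  have key : (((distinctWalks y (t + 1)).filter fun b => b (walkState b y t) = v b) ×ˢ
      (Finset.univ : Finset (Fin m))).card = (distinctWalks y (t + 1)).card := by
    -- Overwrite the prescribed response at state `t` by an arbitrary `c`; the inverse restores `v
    -- b` and records the overwritten value. Both maps fix the walk up to time `t`, hence the state
    -- where they act.
    refine Finset.card_bij' (fun p _ => Function.update p.1 (walkState p.1 y t) p.2)
      (fun b _ => (Function.update b (walkState b y t) (v b), b (walkState b y t))) ?_ ?_ ?_ ?_
    · rintro ⟨b, c⟩ hp
      simp only [Finset.mem_product, Finset.mem_filter] at hp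
      exact update_mem_distinctWalks hp.1.1 c
    · intro b hb
      simp only [Finset.mem_product, Finset.mem_filter, Finset.mem_univ, and_true]
      refine ⟨update_mem_distinctWalks hb _, ?_⟩
      rw [walkState_update hb _ t le_rfl, Function.update_self, hv b hb]
    · rintro ⟨b, c⟩ hp
      simp only [Finset.mem_product, Finset.mem_filter] at hp
      obtain ⟨⟨hb, hbv⟩, -⟩ := hp
      simp only [walkState_update hb _ t le_rfl, Function.update_self, hv b hb,
        Function.update_idem, ← hbv, Function.update_eq_self]
    · intro b hb
      simp only [walkState_update hb _ t le_rfl, Function.update_idem, Function.update_eq_self]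
  rw [Finset.card_product, Finset.card_univ, Fintype.card_fin, mul_comm] at key
  exact key

open Classical in
/-- A walk without repetitions returns to the state visited `2 * j` steps before with
probability `1 / m`. -/
theorem card_return_eq (y : Fin m) (t j : ℕ) (hj : 1 ≤ j) (hjt : 2 * j ≤ t) :
    m * ((distinctWalks y t).filter
      fun b => walkState b y t = walkState b y (t - 2 * j)).card = (distinctWalks y t).card := by
  obtain ⟨t, rfl⟩ : ∃ t', t = t' + 1 := ⟨t - 1, by omega⟩
  rw [← card_response_eq y t (fun b => (walkState b y (t + 1 - 2 * j)).2)]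
  · congr 2
    ext b
    simp only [Finset.mem_filter, and_congr_right_iff]
    intro _
    rw [walkState_eq_iff, walkState_succ_snd, and_iff_right (by omega)]
  · intro b hb c
    rw [walkState_update hb c _ (by omega)]

/-- The probability that the first `t` states of the walk are distinct. -/
noncomputable def freshProb (m t : ℕ) : ℝ := ∏ r ∈ Finset.range t, (1 - ((r / 2 : ℕ) : ℝ) / m)

-- The two players' states never coincide, so state `t` can repeat only a state at even distance `2
-- * j` with `1 ≤ j ≤ t / 2`. These events are disjoint since the earlier states are distinct, and
-- each has conditional probability `1 / m`.
open Classical in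
theorem card_distinctWalks_succ (y : Fin m) (t : ℕ) :
    (m : ℝ) * (distinctWalks y (t + 1)).card =
      (m - (t / 2 : ℕ)) * (distinctWalks y t).card := by
  have hunion : distinctWalks y t = distinctWalks y (t + 1) ∪
      (Finset.Icc 1 (t / 2)).biUnion fun j => (distinctWalks y t).filter
        fun b => walkState b y t = walkState b y (t - 2 * j) := by
    ext b
    simp only [Finset.mem_union, Finset.mem_biUnion, Finset.mem_filter, mem_distinctWalks,
      Finset.mem_Icc]
    constructor
    · intro h
      by_cases hex : ∃ s < t, walkState b y t = walkState b y s
      · obtain ⟨s, hs, he⟩ := hex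
        have hpar := ((walkState_eq_iff _ _ _ _ _ _).1 he).1
        refine Or.inr ⟨(t - s) / 2, by omega, h, ?_⟩
        rwa [show t - 2 * ((t - s) / 2) = s by omega]
      · push Not at hex
        left
        intro r hr s hs he
        simp only [Set.mem_Iio] at hr hs
        rcases Nat.lt_succ_iff_lt_or_eq.1 hr with hr | rfl <;>
          rcases Nat.lt_succ_iff_lt_or_eq.1 hs with hs | rfl
        · exact h hr hs he
        · exact absurd he.symm (hex r hr)
        · exact absurd he (hex s hs)
        · rfl
    · rintro (h | ⟨j, -, h, -⟩)
      · exact h.mono (Set.Iio_subset_Iio (by omega))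
      · exact h
  have hdisj : Disjoint (distinctWalks y (t + 1))
      ((Finset.Icc 1 (t / 2)).biUnion fun j => (distinctWalks y t).filter
        fun b => walkState b y t = walkState b y (t - 2 * j)) := by
    rw [Finset.disjoint_left]
    intro b hb hb'
    simp only [Finset.mem_biUnion, Finset.mem_filter, Finset.mem_Icc] at hb'
    obtain ⟨j, hj, -, he⟩ := hb'
    have := mem_distinctWalks.1 hb (Set.mem_Iio.2 (by omega)) (Set.mem_Iio.2 (by omega)) he
    omega
  have hcard := congrArg Finset.card hunion
  rw [Finset.card_union_of_disjoint hdisj, Finset.card_biUnion] at hcard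
  · have hmul := congrArg (m * ·) hcard
    simp only [mul_add, Finset.mul_sum] at hmul
    rw [Finset.sum_congr rfl fun j hj => card_return_eq y t j (Finset.mem_Icc.1 hj).1
      (by have := (Finset.mem_Icc.1 hj).2; omega)] at hmul
    simp only [Finset.sum_const, Nat.card_Icc, add_tsub_cancel_right, smul_eq_mul] at hmul
    have hmul' : (m : ℝ) * (distinctWalks y t).card = m * (distinctWalks y (t + 1)).card +
        (t / 2 : ℕ) * (distinctWalks y t).card := by exact_mod_cast hmul
    linarith
  · intro i hi j hj hij
    rw [Function.onFun, Finset.disjoint_left]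
    intro b hb hb'
    simp only [Finset.mem_filter, mem_distinctWalks] at hb hb'
    have hi' := Finset.mem_Icc.1 hi
    have hj' := Finset.mem_Icc.1 hj
    have := hb.1 (Set.mem_Iio.2 (by omega)) (Set.mem_Iio.2 (by omega)) (hb.2.symm.trans hb'.2)
    omega

theorem card_distinctWalks (y : Fin m) (t : ℕ) :
    ((distinctWalks y t).card : ℝ) = freshProb m t * m ^ (2 * m) := by
  have hm : (m : ℝ) ≠ 0 := by
    have := y.pos
    positivity
  induction t with
  | zero => simp [distinctWalks, freshProb]
  | succ t ih =>
    have h := card_distinctWalks_succ y t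
    rw [ih] at h
    rw [freshProb, Finset.prod_range_succ, ← freshProb]
    field_simp
    linarith

/-- The walk closes a cycle of length `2 * k` when it first repeats a state. -/
def WalkCycle (b : Fin 2 × Fin m → Fin m) (y : Fin m) (k : ℕ) : Prop :=
  ∃ s : ℕ, Set.InjOn (walkState b y) (Set.Iio (s + 2 * k)) ∧
    walkState b y (s + 2 * k) = walkState b y s

-- Split by the time `s` at which the cycle starts: the first `s + 2 * k` states are distinct and
-- the next one returns to state `s`.
open Classical in
theorem card_walkCycle (y : Fin m) {k : ℕ} (hk : 1 ≤ k) :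
    ((Finset.univ.filter fun b => WalkCycle b y k).card : ℝ) =
      (∑ s ∈ Finset.range (2 * m + 1), freshProb m (s + 2 * k)) / m * m ^ (2 * m) := by
  have hm : (m : ℝ) ≠ 0 := by
    have := y.pos
    positivity
  have hunion : (Finset.univ.filter fun b => WalkCycle b y k) =
      (Finset.range (2 * m + 1)).biUnion fun s => (distinctWalks y (s + 2 * k)).filter
        fun b => walkState b y (s + 2 * k) = walkState b y (s + 2 * k - 2 * k) := by
    ext b
    simp only [Finset.mem_filter, Finset.mem_univ, true_and, Finset.mem_biUnion, Finset.mem_range,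
      mem_distinctWalks, Nat.add_sub_cancel]
    constructor
    · rintro ⟨s, h1, h2⟩
      refine ⟨s, ?_, h1, h2⟩
      -- Pigeonhole: only `2 * m` states exist, which bounds `s`.
      have := Finset.card_le_card_of_injOn (s := Finset.range (s + 2 * k))
        (t := (Finset.univ : Finset (Fin 2 × Fin m))) (walkState b y) (by simp)
        (by simpa using h1)
      simp at this
      omega
    · rintro ⟨s, -, h⟩
      exact ⟨s, h⟩
  rw [hunion, Finset.card_biUnion, Nat.cast_sum, Finset.sum_div, Finset.sum_mul]
  · refine Finset.sum_congr rfl fun s _ => ?_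
    have h := card_return_eq y (s + 2 * k) k hk (by omega)
    have h' := card_distinctWalks y (s + 2 * k)
    rw [← h] at h'
    push_cast at h'
    field_simp
    linarith
  -- A cycle starting at `i` repeats a state at time `i + 2 * k`, too early for the states before `j
  -- + 2 * k` to be distinct; so the starting time is unique.
  · have aux : ∀ (b : Fin 2 × Fin m → Fin m) (i j : ℕ), i < j →
        Set.InjOn (walkState b y) (Set.Iio (j + 2 * k)) →
        walkState b y (i + 2 * k) = walkState b y i → False := by
      intro b i j hij h1 h2
      have := h1 (Set.mem_Iio.2 (by omega)) (Set.mem_Iio.2 (by omega)) h2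
      omega
    intro i _ j _ hij
    rw [Function.onFun, Finset.disjoint_left]
    intro b hb hb'
    simp only [Finset.mem_filter, mem_distinctWalks, Nat.add_sub_cancel] at hb hb'
    rcases lt_or_gt_of_ne hij with h | h
    · exact aux b i j h hb'.1 hb.2
    · exact aux b j i h hb.1 hb'.2

end Walk

/-! ### Uniqueness of the limiting cycle length -/

section Cycles

theorem RepeatsFrom.mul {α : Type*} {a : ℕ → α} {k t : ℕ} (h : RepeatsFrom a k t) (N : ℕ) :
    RepeatsFrom a (N * k) t := by
  induction N with
  | zero => intro r _; simp
  | succ N ih =>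
    intro r hr
    rw [show r + 2 * ((N + 1) * k) = r + 2 * (N * k) + 2 * k by ring, h _ (by omega), ih r hr]

/-- A period that holds eventually holds from any time at which the path is periodic. -/
theorem RepeatsFrom.transfer {α : Type*} {a : ℕ → α} {j k t t' : ℕ} (hj : 1 ≤ j)
    (h : RepeatsFrom a k t) (h' : RepeatsFrom a j t') : RepeatsFrom a k t' := by
  intro r hr
  have hN := h'.mul t
  have htj : t ≤ t * j := Nat.le_mul_of_pos_right t hj
  rw [← hN r hr, ← hN (r + 2 * k) (by omega), ← h (r + 2 * (t * j)) (by omega)]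
  congr 1
  ring

theorem ConvergesToCycleAt.le {α : Type*} {a : ℕ → α} {j k t t' : ℕ}
    (h : ConvergesToCycleAt a k t) (h' : ConvergesToCycleAt a j t') : k ≤ j := by
  by_contra! hlt
  exact h.2.2.1 j h'.1 hlt (h'.2.1.transfer h.1 h.2.1)

theorem ConvergesToCycle.unique {α : Type*} {a : ℕ → α} {j k : ℕ}
    (h : ConvergesToCycle a k) (h' : ConvergesToCycle a j) : k = j := by
  obtain ⟨t, h⟩ := h
  obtain ⟨t', h'⟩ := h'
  exact le_antisymm (h.le h') (h'.le h)

end Cycles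

/-! ### From the best-response dynamic to the walk -/

section Dynamics

variable {m : ℕ}

/-- The profile in which player `i` plays `x` and the other player plays `e`. -/
def lineProfile (i : Fin 2) (e x : Fin m) : Profile (fun _ : Fin 2 => m) :=
  Function.update (fun _ => e) i x

theorem update_eq_lineProfile (a : Profile (fun _ : Fin 2 => m)) (i : Fin 2) (x : Fin m) :
    Function.update a i x = lineProfile i (a (i + 1)) x := by
  funext j
  fin_cases i <;> fin_cases j <;> simp [lineProfile]

/-- `b` is the response function of the game `u`: the action `b (i, e)` is the only best response
of player `i` to the action `e` of the other player. -/
def IsResponse (b : Fin 2 × Fin m → Fin m) (u : Game (fun _ : Fin 2 => m)) : Prop :=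
  ∀ (i : Fin 2) (e y : Fin m), y ≠ b (i, e) →
    u i (lineProfile i e y) < u i (lineProfile i e (b (i, e)))

theorem IsResponse.mem_bestResponses_iff {b : Fin 2 × Fin m → Fin m}
    {u : Game (fun _ : Fin 2 => m)} (h : IsResponse b u) (i : Fin 2)
    (a : Profile (fun _ : Fin 2 => m)) (x : Fin m) :
    x ∈ bestResponses u i a ↔ x = b (i, a (i + 1)) := by
  simp only [bestResponses, Set.mem_ofPred_eq, update_eq_lineProfile]
  constructor
  · intro hx
    by_contra hne
    exact absurd (hx (b (i, a (i + 1)))) (not_le.2 (h i _ x hne))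
  · rintro rfl y
    by_cases hy : y = b (i, a (i + 1))
    · rw [hy]
    · exact (h i _ y hy).le

theorem IsResponse.uniqueBestResponses {b : Fin 2 × Fin m → Fin m}
    {u : Game (fun _ : Fin 2 => m)} (h : IsResponse b u) : UniqueBestResponses u := by
  intro i a
  exact ⟨b (i, a (i + 1)), (h.mem_bestResponses_iff i a _).2 rfl,
    fun y hy => (h.mem_bestResponses_iff i a y).1 hy⟩

theorem IsResponse.unique {b b' : Fin 2 × Fin m → Fin m} {u : Game (fun _ : Fin 2 => m)}
    (h : IsResponse b u) (h' : IsResponse b' u) : b = b' := by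
  funext ⟨i, e⟩
  by_contra hne
  exact lt_asymm (h i e _ (Ne.symm hne)) (h' i e _ hne)

theorem UniqueBestResponses.exists_isResponse {u : Game (fun _ : Fin 2 => m)}
    (h : UniqueBestResponses u) : ∃ b, IsResponse b u := by
  choose f hf hu using h
  refine ⟨fun p => f p.1 (fun _ => p.2), fun i e y hy => ?_⟩
  by_contra! hle
  refine hy (hu i (fun _ => e) y fun z => ?_)
  exact (hf i (fun _ => e) z).trans hle

theorem uniqueBestResponses_iff {u : Game (fun _ : Fin 2 => m)} :
    UniqueBestResponses u ↔ ∃ b, IsResponse b u :=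
  ⟨fun h => h.exists_isResponse, fun ⟨_, h⟩ => h.uniqueBestResponses⟩

/-- The path of the best-response dynamic with response function `b`. -/
def responsePath (b : Fin 2 × Fin m → Fin m) (a₀ : Profile (fun _ : Fin 2 => m)) :
    ℕ → Profile (fun _ : Fin 2 => m)
  | 0 => a₀
  | t + 1 => Function.update (responsePath b a₀ t) (clockwork 2 (t + 1))
      (b (clockwork 2 (t + 1), responsePath b a₀ t (clockwork 2 (t + 1) + 1)))

theorem IsResponse.isBestResponsePath_iff {b : Fin 2 × Fin m → Fin m}
    {u : Game (fun _ : Fin 2 => m)} (h : IsResponse b u) (a₀ : Profile (fun _ : Fin 2 => m))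
    (a : ℕ → Profile (fun _ : Fin 2 => m)) :
    IsBestResponsePath u (clockwork 2) a₀ a ↔ a = responsePath b a₀ := by
  constructor
  · rintro ⟨h0, hs⟩
    funext t
    induction t with
    | zero => exact h0
    | succ t ih =>
      obtain ⟨x, hx, hat⟩ := hs t
      rw [h.mem_bestResponses_iff] at hx
      rw [hat, hx, ih, responsePath]
  · rintro rfl
    exact ⟨rfl, fun t => ⟨_, (h.mem_bestResponses_iff _ _ _).2 rfl, rfl⟩⟩

variable (b : Fin 2 × Fin m → Fin m) (a₀ : Profile (fun _ : Fin 2 => m))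

theorem clockwork_two_succ (t : ℕ) : clockwork 2 (t + 1) = Fin.ofNat 2 t := rfl

theorem ofNat_two_succ (t : ℕ) : Fin.ofNat 2 (t + 1) = Fin.ofNat 2 t + 1 := by
  ext
  simp [Fin.val_add]

theorem fin_two_add_one_add_one (i : Fin 2) : i + 1 + 1 = i := by
  fin_cases i <;> rfl

theorem fin_two_add_one_ne (i : Fin 2) : i + 1 ≠ i := by
  fin_cases i <;> decide

theorem fin_two_eq_or_eq_add_one (i j : Fin 2) : j = i ∨ j = i + 1 := by
  fin_cases i <;> fin_cases j <;> decide

/-- After `t` moves the next mover is `Fin.ofNat 2 t`; the opponent's action she faces is the second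
component of state `t`. -/
theorem responsePath_apply_environment (t : ℕ) :
    responsePath b a₀ t (Fin.ofNat 2 t + 1) = (walkState b (a₀ 1) t).2 := by
  induction t with
  | zero => rfl
  | succ t ih =>
    rw [responsePath, walkState_succ_snd, clockwork_two_succ, ofNat_two_succ,
      fin_two_add_one_add_one, Function.update_self, ih]
    congr 1
    exact Prod.ext (walkState_fst _ _ _).symm rfl

theorem responsePath_succ_apply_mover (t : ℕ) :
    responsePath b a₀ (t + 1) (Fin.ofNat 2 t) = (walkState b (a₀ 1) (t + 1)).2 := by
  rw [← responsePath_apply_environment, ofNat_two_succ, fin_two_add_one_add_one]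

theorem responsePath_succ_apply_environment (t : ℕ) :
    responsePath b a₀ (t + 1) (Fin.ofNat 2 t + 1) = (walkState b (a₀ 1) t).2 := by
  rw [responsePath, clockwork_two_succ, Function.update_of_ne (fin_two_add_one_ne _),
    responsePath_apply_environment]

/-- Profile `r + 1` consists of the actions in states `r` and `r + 1`, and the latter state is
determined by the former. -/
theorem responsePath_succ_eq_iff {r s : ℕ} (hrs : r % 2 = s % 2) :
    responsePath b a₀ (r + 1) = responsePath b a₀ (s + 1) ↔
      walkState b (a₀ 1) r = walkState b (a₀ 1) s := by
  have hp : Fin.ofNat 2 r = Fin.ofNat 2 s := (ofNat_two_eq_iff r s).2 hrs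
  constructor
  · intro h
    rw [walkState_eq_iff]
    refine ⟨hrs, ?_⟩
    rw [← responsePath_succ_apply_environment, ← responsePath_succ_apply_environment, h, hp]
  · intro h
    funext j
    rcases fin_two_eq_or_eq_add_one (Fin.ofNat 2 r) j with rfl | rfl
    · rw [responsePath_succ_apply_mover, hp, responsePath_succ_apply_mover, walkState_succ_snd,
        walkState_succ_snd, h]
    · rw [responsePath_succ_apply_environment, hp, responsePath_succ_apply_environment, h]

theorem repeatsFrom_responsePath_iff (k s : ℕ) :
    RepeatsFrom (responsePath b a₀) k (s + 1) ↔
      walkState b (a₀ 1) (s + 2 * k) = walkState b (a₀ 1) s := by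
  have key : ∀ r, responsePath b a₀ (r + 1 + 2 * k) = responsePath b a₀ (r + 1) ↔
      walkState b (a₀ 1) (r + 2 * k) = walkState b (a₀ 1) r := fun r => by
    rw [← responsePath_succ_eq_iff b a₀ (by omega), Nat.add_right_comm]
  constructor
  · intro h
    exact (key s).1 (h (s + 1) le_rfl)
  · intro h r hr
    obtain ⟨r, rfl⟩ : ∃ r', r = r' + 1 := ⟨r - 1, by omega⟩
    exact (key r).2 (walkState_periodic h r (by omega))

theorem WalkCycle.convergesToCycle {k : ℕ} (hk : 1 ≤ k) (h : WalkCycle b (a₀ 1) k) :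
    ConvergesToCycle (responsePath b a₀) k := by
  obtain ⟨s, hinj, hs⟩ := h
  refine ⟨s + 1, hk, (repeatsFrom_responsePath_iff b a₀ k s).2 hs, ?_, ⟨by omega, rfl⟩, ?_⟩
  · intro j hj hjk hrep
    rw [repeatsFrom_responsePath_iff] at hrep
    have := hinj (Set.mem_Iio.2 (by omega)) (Set.mem_Iio.2 (by omega)) hrep
    omega
  · rintro r ⟨hr, hra⟩
    obtain ⟨r, rfl⟩ : ∃ r', r = r' + 1 := ⟨r - 1, by omega⟩
    by_contra! hlt
    rcases Nat.mod_two_eq_zero_or_one (r + s) with hpar | hpar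
    · rw [responsePath_succ_eq_iff b a₀ (by omega)] at hra
      have := hinj (Set.mem_Iio.2 (by omega)) (Set.mem_Iio.2 (by omega)) hra
      omega
    -- At opposite parity equal profiles match crosswise, so state `r` equals state `s + 1`. Both
    -- times lie below `s + 2 * k`, contradicting distinctness.
    · have h1 : Fin.ofNat 2 (s + 1) = Fin.ofNat 2 r := (ofNat_two_eq_iff _ _).2 (by omega)
      rw [ofNat_two_succ] at h1
      have h2 := congrFun hra (Fin.ofNat 2 s + 1)
      have h3 := congrFun hra (Fin.ofNat 2 s)
      rw [responsePath_succ_apply_environment, h1, responsePath_succ_apply_mover] at h2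
      rw [responsePath_succ_apply_mover, ← fin_two_add_one_add_one (Fin.ofNat 2 s), h1,
        responsePath_succ_apply_environment] at h3
      have e2 : walkState b (a₀ 1) (r + 1) = walkState b (a₀ 1) s :=
        (walkState_eq_iff _ _ _ _ _ _).2 ⟨by omega, h2⟩
      have e3 : walkState b (a₀ 1) r = walkState b (a₀ 1) (s + 1) :=
        (walkState_eq_iff _ _ _ _ _ _).2 ⟨by omega, h3⟩
      have := hinj (Set.mem_Iio.2 (by omega)) (Set.mem_Iio.2 (by omega)) e3
      omega

theorem exists_walkCycle_of_eq {s k : ℕ} (y : Fin m) (hk : 1 ≤ k)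
    (h : walkState b y (s + 2 * k) = walkState b y s) : ∃ j, 1 ≤ j ∧ WalkCycle b y j := by
  classical
  -- The first time at which any state is repeated closes the cycle.
  have hex : ∃ n, ∃ r < n, walkState b y n = walkState b y r := ⟨s + 2 * k, s, by omega, h⟩
  obtain ⟨r, hr, he⟩ := Nat.find_spec hex
  have hpar := ((walkState_eq_iff _ _ _ _ _ _).1 he).1
  have hn : Nat.find hex = r + 2 * ((Nat.find hex - r) / 2) := by omega
  refine ⟨(Nat.find hex - r) / 2, by omega, r, ?_, by rwa [← hn]⟩
  rw [← hn]
  intro i hi j hj hij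
  by_contra hne
  rcases lt_or_gt_of_ne hne with hlt | hlt
  · exact Nat.find_min hex hj ⟨i, hlt, hij.symm⟩
  · exact Nat.find_min hex hi ⟨j, hlt, hij⟩

/-- Any convergence forces the walk to close some cycle of length `2 * j`; then the path also
converges to a `2j`-cycle, and uniqueness gives `j = k`. -/
theorem convergesToCycle_responsePath_iff {k : ℕ} (hk : 1 ≤ k) :
    ConvergesToCycle (responsePath b a₀) k ↔ WalkCycle b (a₀ 1) k := by
  refine ⟨fun h => ?_, fun h => h.convergesToCycle b a₀ hk⟩
  obtain ⟨t, -, hrep, -, ⟨ht, -⟩, -⟩ := id h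
  obtain ⟨s, rfl⟩ : ∃ s, t = s + 1 := ⟨t - 1, by omega⟩
  rw [repeatsFrom_responsePath_iff] at hrep
  obtain ⟨j, hj, hw⟩ := exists_walkCycle_of_eq b _ hk hrep
  rwa [h.unique (hw.convergesToCycle b a₀ hj)]

variable {b}

theorem IsResponse.isPureNash_iff {u : Game (fun _ : Fin 2 => m)} (h : IsResponse b u)
    (a : Profile (fun _ : Fin 2 => m)) :
    IsPureNash u a ↔ ∀ i, b (i, a (i + 1)) = a i := by
  refine forall_congr' fun i => ?_
  rw [eq_comm, ← h.mem_bestResponses_iff i a]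
  simp [bestResponses]

/-- The path stays at an equilibrium once there. Conversely, a state recurring after two steps means
that the two current actions are best responses to each other. -/
theorem IsResponse.convergesToPureNash_iff {u : Game (fun _ : Fin 2 => m)}
    (h : IsResponse b u) :
    ConvergesToPureNash u (responsePath b a₀) ↔ ConvergesToCycle (responsePath b a₀) 1 := by
  classical
  constructor
  · rintro ⟨t, ht, hN⟩
    rw [h.isPureNash_iff] at hN
    have hconst : ∀ s, (∀ i, b (i, responsePath b a₀ s (i + 1)) = responsePath b a₀ s i) →
        ∀ r, s ≤ r → responsePath b a₀ r = responsePath b a₀ s := by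
      intro s hs r hr
      induction r, hr using Nat.le_induction with
      | base => rfl
      | succ r _ ih => rw [responsePath, ih, hs, Function.update_eq_self]
    -- A cycle must be dated from the first visit at a time `≥ 1`, so `t` is replaced by that time.
    have hex : ∃ r, 1 ≤ r ∧ responsePath b a₀ r = responsePath b a₀ t := ⟨t, ht, rfl⟩
    obtain ⟨h1, h2⟩ := Nat.find_spec hex
    rw [← h2] at hN
    refine ⟨Nat.find hex, le_rfl, fun r hr => ?_, fun j hj hj' => by omega, ⟨h1, rfl⟩, ?_⟩
    · rw [hconst _ hN r hr, hconst _ hN _ (by omega)]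
    · rintro r ⟨hr, hra⟩
      exact Nat.find_min' hex ⟨hr, hra.trans h2⟩
  · rintro ⟨t, -, hrep, -, ⟨ht, -⟩, -⟩
    refine ⟨t, ht, ?_⟩
    rw [h.isPureNash_iff]
    obtain ⟨t, rfl⟩ : ∃ s, t = s + 1 := ⟨t - 1, by omega⟩
    rw [repeatsFrom_responsePath_iff] at hrep
    have e0 := congrArg Prod.snd hrep
    intro i
    rcases fin_two_eq_or_eq_add_one (Fin.ofNat 2 t) i with rfl | rfl
    · rw [responsePath_succ_apply_environment, responsePath_succ_apply_mover, walkState_succ_snd]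
      congr 1
      exact Prod.ext (walkState_fst _ _ _).symm rfl
    · rw [fin_two_add_one_add_one, responsePath_succ_apply_environment,
        responsePath_succ_apply_mover, ← e0, show t + 2 * 1 = t + 1 + 1 from rfl,
        walkState_succ_snd]
      congr 1
      exact Prod.ext (by rw [walkState_fst, ofNat_two_succ]) rfl

end Dynamics

/-! ### Uniformity of the best-response function and the exact cycle probability -/

section Measure

variable {m : ℕ}

/-- The law of the payoffs of a random two-player game. -/
noncomputable def payoffLaw (P : Measure ℝ) (m : ℕ) : Measure (Game (fun _ : Fin 2 => m)) :=
  Measure.pi fun _ : Fin 2 => Measure.pi fun _ : Profile (fun _ : Fin 2 => m) => P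

instance (P : Measure ℝ) [IsProbabilityMeasure P] (m : ℕ) :
    IsProbabilityMeasure (payoffLaw P m) := by
  unfold payoffLaw
  infer_instance

theorem lineProfile_apply_self (i : Fin 2) (e x : Fin m) : lineProfile i e x i = x := by
  simp [lineProfile]

theorem lineProfile_apply_add_one (i : Fin 2) (e x : Fin m) :
    lineProfile i e x (i + 1) = e := by
  simp [lineProfile]

theorem lineProfile_injective (i : Fin 2) (e : Fin m) :
    Function.Injective (lineProfile i e) := fun x y h => by
  rw [← lineProfile_apply_self i e x, h, lineProfile_apply_self]

theorem measurableSet_isResponse (b : Fin 2 × Fin m → Fin m) :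
    MeasurableSet {u : Game (fun _ : Fin 2 => m) | IsResponse b u} := by
  simp only [IsResponse, Set.ofPred_forall]
  refine MeasurableSet.iInter fun i => MeasurableSet.iInter fun e => MeasurableSet.iInter fun y =>
    MeasurableSet.iInter fun _ => measurableSet_lt ?_ ?_ <;> fun_prop

/-- Exchanges the actions `b (i, e)` and `b' (i, e)` of player `i` in every environment `e`. -/
def swapResponse (b b' : Fin 2 × Fin m → Fin m) (i : Fin 2) (p : Profile (fun _ : Fin 2 => m)) :
    Profile (fun _ : Fin 2 => m) :=
  lineProfile i (p (i + 1))
    (Equiv.swap (b (i, p (i + 1))) (b' (i, p (i + 1))) (p i))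

theorem swapResponse_lineProfile (b b' : Fin 2 × Fin m → Fin m) (i : Fin 2) (e x : Fin m) :
    swapResponse b b' i (lineProfile i e x) =
      lineProfile i e (Equiv.swap (b (i, e)) (b' (i, e)) x) := by
  rw [swapResponse, lineProfile_apply_self, lineProfile_apply_add_one]

theorem swapResponse_involutive (b b' : Fin 2 × Fin m → Fin m) (i : Fin 2) :
    Function.Involutive (swapResponse b b' i) := by
  intro p
  conv_lhs => rw [swapResponse.eq_def b b' i p, swapResponse_lineProfile, Equiv.swap_apply_self,
    ← update_eq_lineProfile, Function.update_eq_self]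

/-- The swap permutes the actions in each environment and exchanges the candidate optima `b (i, e)`
and `b' (i, e)`. Together with invariance of the payoff law it makes all response functions equally
likely. -/
theorem isResponse_swapResponse_iff (b b' : Fin 2 × Fin m → Fin m)
    (u : Game (fun _ : Fin 2 => m)) :
    IsResponse b (fun i p => u i (swapResponse b b' i p)) ↔ IsResponse b' u := by
  refine forall_congr' fun i => forall_congr' fun e => ?_
  rw [← (Equiv.swap (b (i, e)) (b' (i, e))).forall_congr_right]
  refine forall_congr' fun y => ?_
  simp only [swapResponse_lineProfile, Equiv.swap_apply_self, Equiv.swap_apply_left]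
  rw [Ne, Equiv.swap_apply_eq_iff, Equiv.swap_apply_left]

theorem probPureNash_eq (P : Measure ℝ) (m : ℕ) : probPureNash P m = probCycle P m 1 := by
  rw [probPureNash, probCycle]
  congr 1
  ext ω
  simp only [Set.mem_ofPred_eq]
  refine and_congr_right fun h => exists_congr fun a => and_congr_right fun ha => ?_
  obtain ⟨b, hb⟩ := h.exists_isResponse
  rw [hb.isBestResponsePath_iff] at ha
  rw [ha, hb.convergesToPureNash_iff]

variable (P : Measure ℝ) [IsProbabilityMeasure P]

theorem measurePreserving_swapResponse (b b' : Fin 2 × Fin m → Fin m) :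
    MeasurePreserving (fun (u : Game (fun _ : Fin 2 => m)) i p => u i (swapResponse b b' i p))
      (payoffLaw P m) (payoffLaw P m) := by
  refine measurePreserving_pi _ _ 
    (f := fun i (v : Profile (fun _ : Fin 2 => m) → ℝ) p => v (swapResponse b b' i p)) fun i => ?_
  have h := measurePreserving_piCongrLeft (fun _ : Profile (fun _ : Fin 2 => m) => P)
    (swapResponse_involutive b b' i).toPerm
  convert h using 1
  funext v p
  obtain ⟨q, rfl⟩ := (swapResponse_involutive b b' i).toPerm.surjective p
  rw [MeasurableEquiv.coe_piCongrLeft, Equiv.piCongrLeft_apply_apply]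
  simp [swapResponse_involutive b b' i q]

theorem payoffLaw_isResponse_eq (b b' : Fin 2 × Fin m → Fin m) :
    (payoffLaw P m).real {u | IsResponse b u} = (payoffLaw P m).real {u | IsResponse b' u} := by
  rw [← (measurePreserving_swapResponse P b b').measureReal_preimage
    (measurableSet_isResponse b).nullMeasurableSet]
  congr 1
  ext u
  exact isResponse_swapResponse_iff b b' u

variable [NullSingletonClass P]

/-- The two coordinates are independent, and the slices of the diagonal are singletons, which are
null for `P`. -/
theorem measure_pi_tie {ι : Type*} [Fintype ι] {p q : ι} (hpq : p ≠ q) :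
    (Measure.pi fun _ : ι => P) {v | v p = v q} = 0 := by
  classical
  have hind : iIndepFun (fun (i : ι) (v : ι → ℝ) => v i) (Measure.pi fun _ : ι => P) :=
    iIndepFun_pi (X := fun _ x => x) fun _ => aemeasurable_id
  have hmap := (indepFun_iff_map_prod_eq_prod_map_map (measurable_pi_apply p).aemeasurable
    (measurable_pi_apply q).aemeasurable).1 (hind.indepFun hpq)
  have hdiag : MeasurableSet {x : ℝ × ℝ | x.1 = x.2} :=
    measurableSet_eq_fun measurable_fst measurable_snd
  have hpre : {v : ι → ℝ | v p = v q} = (fun v : ι → ℝ => (v p, v q)) ⁻¹' {x | x.1 = x.2} := rfl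
  rw [hpre, ← Measure.map_apply (by fun_prop) hdiag, hmap,
    (measurePreserving_eval (fun _ : ι => P) p).map_eq,
    (measurePreserving_eval (fun _ : ι => P) q).map_eq, Measure.measure_prod_null hdiag]
  refine Eventually.of_forall fun x => ?_
  have : Prod.mk x ⁻¹' {x : ℝ × ℝ | x.1 = x.2} = {x} := by
    ext z
    simp [eq_comm]
  simp [this]

theorem ae_payoff_ne (i : Fin 2) {p q : Profile (fun _ : Fin 2 => m)} (hpq : p ≠ q) :
    ∀ᵐ u ∂(payoffLaw P m), u i p ≠ u i q := by
  have h := (measurePreserving_eval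
    (fun _ : Fin 2 => Measure.pi fun _ : Profile (fun _ : Fin 2 => m) => P) i)
  have h0 : ∀ᵐ v ∂(Measure.pi fun _ : Profile (fun _ : Fin 2 => m) => P), v p ≠ v q := by
    rw [ae_iff]
    simpa using measure_pi_tie P hpq
  exact h.quasiMeasurePreserving.ae h0

/-- Almost surely the best responses are unique. -/
theorem ae_exists_isResponse (hm : 1 ≤ m) : ∀ᵐ u ∂(payoffLaw P m), ∃ b, IsResponse b u := by
  have hne : ∀ᵐ u ∂(payoffLaw P m), ∀ (i : Fin 2) (p q : Profile (fun _ : Fin 2 => m)),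
      p ≠ q → u i p ≠ u i q := by
    simp only [ae_all_iff]
    exact fun i p q hpq => ae_payoff_ne P i hpq
  have : Nonempty (Fin m) := ⟨⟨0, hm⟩⟩
  filter_upwards [hne] with u hu
  choose f hf using fun s : Fin 2 × Fin m =>
    Finite.exists_max fun x => u s.1 (lineProfile s.1 s.2 x)
  exact ⟨f, fun i e y hy => lt_of_le_of_ne (hf (i, e) y)
    (hu i _ _ fun h => hy (lineProfile_injective i e h))⟩

theorem sum_payoffLaw_isResponse (hm : 1 ≤ m) :
    ∑ b : Fin 2 × Fin m → Fin m, (payoffLaw P m).real {u | IsResponse b u} = 1 := by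
  rw [← measureReal_biUnion_finset]
  · rw [measureReal_def, (prob_compl_eq_zero_iff ?_).1, ENNReal.toReal_one]
    · have h := ae_exists_isResponse P hm
      rw [ae_iff] at h
      convert h using 2
      ext u
      simp
    · exact Finset.measurableSet_biUnion _ fun b _ => measurableSet_isResponse b
  · intro b _ b' _ hbb
    exact Set.disjoint_left.2 fun u hu hu' => hbb (IsResponse.unique hu hu')
  · exact fun b _ => measurableSet_isResponse b

/-- The best-response function of a random game is uniform. -/
theorem payoffLaw_isResponse (hm : 1 ≤ m) (b : Fin 2 × Fin m → Fin m) :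
    (payoffLaw P m).real {u | IsResponse b u} = ((m : ℝ) ^ (2 * m))⁻¹ := by
  have h := sum_payoffLaw_isResponse P hm
  rw [Finset.sum_congr rfl fun b' _ => payoffLaw_isResponse_eq P b' b] at h
  simp only [Finset.sum_const, Finset.card_univ, Fintype.card_pi, Finset.prod_const,
    Fintype.card_prod, Fintype.card_fin, nsmul_eq_mul, Nat.cast_pow] at h
  exact eq_inv_of_mul_eq_one_right h

open Classical in
/-- The probability of an event that depends on the game through its response function and on the
initial action of player `1`, when the number of favourable response functions does not depend on
that action. -/
theorem randomGame_response_event (hm : 1 ≤ m) (R : (Fin 2 × Fin m → Fin m) → Fin m → Prop)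
    {c : ℝ} (hR : ∀ y, ((Finset.univ.filter fun b => R b y).card : ℝ) = c * m ^ (2 * m)) :
    (randomGame P fun _ : Fin 2 => m).real {ω | ∃ b, IsResponse b ω.1 ∧ R b (ω.2 1)} = c := by
  have hset : {ω : Game (fun _ : Fin 2 => m) × Profile (fun _ : Fin 2 => m) |
      ∃ b, IsResponse b ω.1 ∧ R b (ω.2 1)} =
      ⋃ s ∈ (Finset.univ.filter fun s : (Fin 2 × Fin m → Fin m) × Profile (fun _ : Fin 2 => m) =>
        R s.1 (s.2 1)), {u | IsResponse s.1 u} ×ˢ {s.2} := by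
    ext ω
    simp only [Set.mem_ofPred_eq, Set.mem_iUnion, Set.mem_prod, Set.mem_singleton_iff,
      Finset.mem_filter, Finset.mem_univ, true_and, exists_prop, Prod.exists]
    constructor
    · rintro ⟨b, h1, h2⟩
      exact ⟨b, ω.2, h2, h1, rfl⟩
    · rintro ⟨b, a, h1, h2, h3⟩
      exact ⟨b, h2, h3 ▸ h1⟩
  have hm' : (m : ℝ) ≠ 0 := by positivity
  have : Nonempty (Profile (fun _ : Fin 2 => m)) := ⟨fun _ => ⟨0, hm⟩⟩
  have : IsProbabilityMeasure (randomGame P fun _ : Fin 2 => m) := by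
    have := isProbabilityMeasure_uniformOn
      (Set.finite_univ (α := Profile (fun _ : Fin 2 => m))) Set.univ_nonempty
    unfold randomGame
    infer_instance
  rw [hset, measureReal_biUnion_finset]
  · have hterm : ∀ s : (Fin 2 × Fin m → Fin m) × Profile (fun _ : Fin 2 => m),
        (randomGame P fun _ : Fin 2 => m).real ({u | IsResponse s.1 u} ×ˢ {s.2}) =
          ((m : ℝ) ^ (2 * m))⁻¹ * ((m : ℝ) ^ 2)⁻¹ := by
      intro s
      rw [randomGame, measureReal_prod_prod]
      congr 1
      · exact payoffLaw_isResponse P hm s.1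
      · rw [measureReal_def, uniformOn_univ, Measure.count_singleton]
        simp
    rw [Finset.sum_congr rfl fun s _ => hterm s, Finset.sum_const, nsmul_eq_mul]
    have hcard : (((Finset.univ.filter
        fun s : (Fin 2 × Fin m → Fin m) × Profile (fun _ : Fin 2 => m) =>
          R s.1 (s.2 1)).card : ℕ) : ℝ) = m ^ 2 * (c * m ^ (2 * m)) := by
      rw [← Finset.univ_product_univ, Finset.card_filter, Finset.sum_product_right]
      push_cast
      rw [Finset.sum_congr rfl fun a _ => show _ = c * (m : ℝ) ^ (2 * m) by
        rw [← hR (a 1), Finset.card_filter]; push_cast; rfl]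
      simp
    rw [hcard]
    field_simp
  · rintro ⟨b, a⟩ _ ⟨b', a'⟩ _ hne
    refine Set.disjoint_left.2 fun ω hω hω' => hne ?_
    exact Prod.ext (IsResponse.unique hω.1 hω'.1) (hω.2.symm.trans hω'.2)
  · exact fun s _ => (measurableSet_isResponse s.1).prod (measurableSet_singleton _)

theorem probCycle_eq (hm : 1 ≤ m) {k : ℕ} (hk : 1 ≤ k) :
    probCycle P m k = (∑ s ∈ Finset.range (2 * m + 1), freshProb m (s + 2 * k)) / m := by
  rw [probCycle, ← randomGame_response_event P hm (fun b y => WalkCycle b y k)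
    fun y => card_walkCycle y hk]
  congr 1
  ext ω
  simp only [Set.mem_ofPred_eq, uniqueBestResponses_iff]
  constructor
  · rintro ⟨⟨b, hb⟩, a, ha, hc⟩
    rw [hb.isBestResponsePath_iff] at ha
    rw [ha, convergesToCycle_responsePath_iff b _ hk] at hc
    exact ⟨b, hb, hc⟩
  · rintro ⟨b, hb, hc⟩
    exact ⟨⟨b, hb⟩, _, (hb.isBestResponsePath_iff _ _).2 rfl,
      (convergesToCycle_responsePath_iff b _ hk).2 hc⟩

end Measure

/-! ### Gaussian tail estimates -/

section GaussianTail

variable {b : ℝ}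

/-- The tail `∫ exp (-b u ^ 2) du` over `u > x`. -/
noncomputable def gaussianTail (b x : ℝ) : ℝ := ∫ u in Set.Ioi x, Real.exp (-b * u ^ 2)

theorem integrableOn_exp_neg_mul_sq (hb : 0 < b) (s : Set ℝ) :
    IntegrableOn (fun u : ℝ => Real.exp (-b * u ^ 2)) s :=
  (integrable_exp_neg_mul_sq hb).integrableOn

theorem antitoneOn_exp_neg_mul_sq (hb : 0 < b) :
    AntitoneOn (fun u : ℝ => Real.exp (-b * u ^ 2)) (Set.Ici 0) := by
  intro u hu v _ huv
  have : u ^ 2 ≤ v ^ 2 := pow_le_pow_left₀ hu huv 2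
  exact Real.exp_le_exp.2 (by nlinarith)

theorem gaussianTail_nonneg (b x : ℝ) : 0 ≤ gaussianTail b x :=
  setIntegral_nonneg measurableSet_Ioi fun _ _ => (Real.exp_pos _).le

theorem integral_add_gaussianTail (hb : 0 < b) (x y : ℝ) :
    (∫ u in x..y, Real.exp (-b * u ^ 2)) + gaussianTail b y = gaussianTail b x :=
  intervalIntegral.integral_interval_add_Ioi (integrableOn_exp_neg_mul_sq hb _)
    (integrableOn_exp_neg_mul_sq hb _)

theorem integral_exp_neg_mul_sq_le (hb : 0 < b) {x y : ℝ} (hx : 0 ≤ x) (hxy : x ≤ y) :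
    ∫ u in x..y, Real.exp (-b * u ^ 2) ≤ (y - x) * Real.exp (-b * x ^ 2) := by
  rw [← smul_eq_mul, ← intervalIntegral.integral_const]
  refine intervalIntegral.integral_mono_on hxy
    (Continuous.intervalIntegrable (by fun_prop) _ _) (by simp) fun u hu => ?_
  exact antitoneOn_exp_neg_mul_sq hb hx (hx.trans hu.1) hu.1

theorem le_integral_exp_neg_mul_sq (hb : 0 < b) {x y : ℝ} (hx : 0 ≤ x) (hxy : x ≤ y) :
    (y - x) * Real.exp (-b * y ^ 2) ≤ ∫ u in x..y, Real.exp (-b * u ^ 2) := by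
  rw [← smul_eq_mul, ← intervalIntegral.integral_const]
  refine intervalIntegral.integral_mono_on hxy (by simp)
    (Continuous.intervalIntegrable (by fun_prop) _ _) fun u hu => ?_
  exact antitoneOn_exp_neg_mul_sq hb (hx.trans hu.1) (hx.trans hxy) hu.2

theorem le_gaussianTail (hb : 0 < b) {x L : ℝ} (hx : 0 ≤ x) (hL : 0 ≤ L) :
    L * Real.exp (-b * (x + L) ^ 2) ≤ gaussianTail b x := by
  have h1 := le_integral_exp_neg_mul_sq hb hx (by linarith : x ≤ x + L)
  have h2 := integral_add_gaussianTail hb x (x + L)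
  have h3 := gaussianTail_nonneg b (x + L)
  rw [add_sub_cancel_left] at h1
  linarith

theorem gaussianTail_pos (hb : 0 < b) {x : ℝ} (hx : 0 ≤ x) : 0 < gaussianTail b x :=
  lt_of_lt_of_le (mul_pos one_pos (Real.exp_pos _)) (le_gaussianTail hb hx zero_le_one)

/-- Translate by `h` and use `(u + h)² ≥ u² + h²` for `u, h ≥ 0`. The bound is relative to the tail
at `x`, so truncation stays harmless even when that tail is small. -/
theorem gaussianTail_add_le (hb : 0 < b) {x h : ℝ} (hx : 0 ≤ x) (hh : 0 ≤ h) :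
    gaussianTail b (x + h) ≤ Real.exp (-b * h ^ 2) * gaussianTail b x := by
  have hshift := (measurePreserving_add_right (volume : Measure ℝ) h).setIntegral_preimage_emb
    (Homeomorph.addRight h).measurableEmbedding (fun u => Real.exp (-b * u ^ 2)) (Set.Ioi (x + h))
  have hpre : (fun u : ℝ => u + h) ⁻¹' Set.Ioi (x + h) = Set.Ioi x := by
    ext u
    simp
  rw [hpre] at hshift
  rw [gaussianTail, ← hshift, gaussianTail, ← integral_const_mul]
  refine setIntegral_mono_on ?_ ((integrableOn_exp_neg_mul_sq hb _).const_mul _)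
    measurableSet_Ioi fun u hu => ?_
  · exact ((integrable_exp_neg_mul_sq hb).comp_add_right h).integrableOn
  · rw [← Real.exp_add]
    have hu0 : 0 ≤ u * h := mul_nonneg (hx.trans (le_of_lt hu)) hh
    refine Real.exp_le_exp.2 ?_
    nlinarith [mul_nonneg hb.le hu0]

/-- Substitute `u = √(2m) z`, turning `u² / (4m)` into `z² / 2`. -/
theorem gaussianTail_eq_stdNormalCDF {m : ℝ} (hm : 0 < m) (x : ℝ) :
    gaussianTail (1 / (4 * m)) x =
      2 * Real.sqrt (Real.pi * m) * (1 - stdNormalCDF (x / Real.sqrt (2 * m))) := by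
  have h2m : 0 < Real.sqrt (2 * m) := Real.sqrt_pos.2 (by positivity)
  have hcdf : ∀ y, 1 - stdNormalCDF y =
      (Real.sqrt (2 * Real.pi))⁻¹ * ∫ z in Set.Ioi y, Real.exp (-(1 / 2) * z ^ 2) := by
    intro y
    rw [stdNormalCDF, cdf_eq_real, ← probReal_compl_eq_one_sub measurableSet_Iic, Set.compl_Iic,
      measureReal_def, gaussianReal_apply_eq_integral 0 one_ne_zero, ENNReal.toReal_ofReal
        (setIntegral_nonneg measurableSet_Ioi fun _ _ => gaussianPDFReal_nonneg _ _ _),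
      ← integral_const_mul]
    refine setIntegral_congr_fun measurableSet_Ioi fun z _ => ?_
    simp only [gaussianPDFReal_def, NNReal.coe_one, mul_one, sub_zero]
    congr 2
    ring
  have hsub := integral_comp_mul_left_Ioi (fun u => Real.exp (-(1 / (4 * m)) * u ^ 2))
    (x / Real.sqrt (2 * m)) h2m
  rw [mul_div_cancel₀ _ h2m.ne', smul_eq_mul] at hsub
  have hint : (∫ z in Set.Ioi (x / Real.sqrt (2 * m)),
      Real.exp (-(1 / (4 * m)) * (Real.sqrt (2 * m) * z) ^ 2)) =
      ∫ z in Set.Ioi (x / Real.sqrt (2 * m)), Real.exp (-(1 / 2) * z ^ 2) := by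
    congr 1
    funext z
    rw [mul_pow, Real.sq_sqrt (by positivity)]
    congr 1
    field_simp
    ring
  rw [hint] at hsub
  rw [hcdf, hsub, ← gaussianTail, ← mul_assoc, ← mul_assoc]
  have hsq : 2 * Real.sqrt (Real.pi * m) = Real.sqrt (2 * Real.pi) * Real.sqrt (2 * m) := by
    rw [← Real.sqrt_mul (by positivity), show 2 * Real.pi * (2 * m) = 2 ^ 2 * (Real.pi * m) by ring,
      Real.sqrt_mul (by norm_num : (0 : ℝ) ≤ 2 ^ 2), Real.sqrt_sq (by norm_num)]
  have hpi : Real.sqrt (2 * Real.pi) ≠ 0 := (Real.sqrt_pos.2 (by positivity)).ne'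
  rw [hsq]
  field_simp

theorem gaussianTail_zero {m : ℝ} (hm : 0 < m) :
    gaussianTail (1 / (4 * m)) 0 = Real.sqrt (Real.pi * m) := by
  rw [gaussianTail, integral_gaussian_Ioi,
    show Real.pi / (1 / (4 * m)) = 2 ^ 2 * (Real.pi * m) by field_simp; norm_num,
    Real.sqrt_mul (by positivity), Real.sqrt_sq (by norm_num)]
  ring

end GaussianTail

/-! ### Comparison of the birthday sum with the Gaussian tail -/

section FreshProb

/-- The square is centred at `1`, which is why the tail starts at `2k - 1`; the parity term is `1`
for even `t` and `0` for odd `t`. -/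
theorem four_mul_sum_half (t : ℕ) :
    4 * ∑ r ∈ Finset.range t, ((r / 2 : ℕ) : ℝ) = ((t : ℝ) - 1) ^ 2 - ((t + 1) % 2 : ℕ) := by
  induction t with
  | zero => norm_num
  | succ t ih =>
    have h : 4 * (t / 2) + 1 + (t + 1 + 1) % 2 = 2 * t + (t + 1) % 2 := by omega
    have h' : (4 : ℝ) * (t / 2 : ℕ) + 1 + ((t + 1 + 1) % 2 : ℕ) = 2 * t + ((t + 1) % 2 : ℕ) := by
      exact_mod_cast h
    rw [Finset.sum_range_succ, mul_add, ih]
    push_cast at h' ⊢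
    linarith

theorem freshProb_nonneg {m : ℕ} (hm : 1 ≤ m) (t : ℕ) : 0 ≤ freshProb m t := by
  by_cases ht : t ≤ 2 * m + 1
  · refine Finset.prod_nonneg fun r hr => ?_
    have hr' := Finset.mem_range.1 hr
    rw [sub_nonneg, div_le_one (by positivity)]
    exact_mod_cast (by omega : r / 2 ≤ m)
  -- Later factors may be negative, but the factor at `r = 2 * m` is zero.
  · rw [freshProb, Finset.prod_eq_zero (i := 2 * m) (Finset.mem_range.2 (by omega))]
    rw [Nat.mul_div_cancel_left _ two_pos, div_self (by positivity), sub_self]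

/-- Apply `1 - x ≤ exp (-x)` to each factor; the prefactor `exp (1 / (4 * m))` absorbs the parity
term. -/
theorem freshProb_le {m : ℕ} (hm : 1 ≤ m) (t : ℕ) :
    freshProb m t ≤
      Real.exp (1 / (4 * m)) * Real.exp (-(1 / (4 * m)) * ((t : ℝ) - 1) ^ 2) := by
  have hm0 : (0 : ℝ) < m := by positivity
  by_cases ht : t ≤ 2 * m + 1
  · have h1 : freshProb m t ≤ ∏ r ∈ Finset.range t, Real.exp (-(((r / 2 : ℕ) : ℝ) / m)) := by
      refine Finset.prod_le_prod (fun r hr => ?_) fun r _ => ?_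
      · have hr' := Finset.mem_range.1 hr
        rw [sub_nonneg, div_le_one (by positivity)]
        exact_mod_cast (by omega : r / 2 ≤ m)
      · linarith [Real.add_one_le_exp (-(((r / 2 : ℕ) : ℝ) / m))]
    refine h1.trans ?_
    rw [← Real.exp_sum, ← Real.exp_add, Real.exp_le_exp, Finset.sum_neg_distrib, ← Finset.sum_div]
    have h2 := four_mul_sum_half t
    have h3 : (((t + 1) % 2 : ℕ) : ℝ) ≤ 1 := by
      exact_mod_cast (by omega : (t + 1) % 2 ≤ 1)
    have h4 : ((t : ℝ) - 1) ^ 2 - 1 ≤ 4 * ∑ r ∈ Finset.range t, ((r / 2 : ℕ) : ℝ) := by linarith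
    have h5 := div_le_div_of_nonneg_right h4 (by positivity : (0 : ℝ) ≤ 4 * m)
    rw [mul_div_mul_left _ _ (by norm_num : (4 : ℝ) ≠ 0), sub_div] at h5
    rw [neg_mul, one_div_mul_eq_div]
    linarith
  · rw [freshProb, Finset.prod_eq_zero (i := 2 * m) (Finset.mem_range.2 (by omega))]
    · positivity
    · rw [Nat.mul_div_cancel_left _ two_pos, div_self (by positivity), sub_self]

theorem exp_neg_sub_two_mul_sq_le {x : ℝ} (hx : x ≤ 1 / 2) :
    Real.exp (-x - 2 * x ^ 2) ≤ 1 - x := by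
  have hpos : 0 < 1 - x := by linarith
  rw [← Real.le_log_iff_exp_le hpos]
  refine le_trans ?_ (Real.one_sub_inv_le_log_of_pos hpos)
  rw [← sub_nonneg, show 1 - (1 - x)⁻¹ - (-x - 2 * x ^ 2) = x ^ 2 * (1 - 2 * x) / (1 - x) by
    field_simp; ring]
  have : 0 ≤ 1 - 2 * x := by linarith
  positivity

/-- Apply `1 - x ≥ exp (-x - 2x²)` to each factor. The quadratic terms total at most `T³ / m²`, one
source of the threshold `m^{2/3}`. -/
theorem le_freshProb {m t T : ℕ} (hm : 1 ≤ m) (htT : t ≤ T) (hT : T ≤ m) :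
    Real.exp (-((T : ℝ) ^ 3 / m ^ 2)) * Real.exp (-(1 / (4 * m)) * ((t : ℝ) - 1) ^ 2) ≤
      freshProb m t := by
  have hm0 : (0 : ℝ) < m := by positivity
  have h1 : ∏ r ∈ Finset.range t,
      Real.exp (-(((r / 2 : ℕ) : ℝ) / m) - 2 * (((r / 2 : ℕ) : ℝ) / m) ^ 2) ≤ freshProb m t := by
    refine Finset.prod_le_prod (fun _ _ => (Real.exp_pos _).le) fun r hr => ?_
    have hr' := Finset.mem_range.1 hr
    refine exp_neg_sub_two_mul_sq_le ?_
    rw [div_le_div_iff₀ hm0 two_pos]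
    exact_mod_cast (by omega : r / 2 * 2 ≤ 1 * m)
  refine le_trans ?_ h1
  rw [← Real.exp_sum, ← Real.exp_add, Real.exp_le_exp, Finset.sum_sub_distrib,
    Finset.sum_neg_distrib, ← Finset.sum_div]
  have h2 := four_mul_sum_half t
  have h4 : 4 * ∑ r ∈ Finset.range t, ((r / 2 : ℕ) : ℝ) ≤ ((t : ℝ) - 1) ^ 2 := by
    linarith [Nat.cast_nonneg (α := ℝ) ((t + 1) % 2)]
  have h5 := div_le_div_of_nonneg_right h4 (by positivity : (0 : ℝ) ≤ 4 * m)
  rw [mul_div_mul_left _ _ (by norm_num : (4 : ℝ) ≠ 0)] at h5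
  have h6 : ∑ r ∈ Finset.range t, 2 * (((r / 2 : ℕ) : ℝ) / m) ^ 2 ≤ (T : ℝ) ^ 3 / m ^ 2 := by
    calc ∑ r ∈ Finset.range t, 2 * (((r / 2 : ℕ) : ℝ) / m) ^ 2
        ≤ ∑ r ∈ Finset.range t, (T : ℝ) ^ 2 / m ^ 2 := by
          refine Finset.sum_le_sum fun r hr => ?_
          have hr' := Finset.mem_range.1 hr
          have h : 2 * ((r / 2 : ℕ) : ℝ) ≤ T := by exact_mod_cast (by omega : 2 * (r / 2) ≤ T)
          rw [div_pow, ← mul_div_assoc]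
          gcongr
          nlinarith [Nat.cast_nonneg (α := ℝ) (r / 2)]
      _ = t * ((T : ℝ) ^ 2 / m ^ 2) := by simp
      _ ≤ T * ((T : ℝ) ^ 2 / m ^ 2) := by gcongr
      _ = (T : ℝ) ^ 3 / m ^ 2 := by ring
  rw [neg_mul, one_div_mul_eq_div]
  linarith

variable {m k : ℕ}

/-- Integral comparison from above starts at `2k - 2`, one unit too early. The extra strip is at
most its left-end value, which is controlled by the tail itself through a rectangle of width `L`
beyond `2k - 1`; `L` is left free to be optimised. -/
theorem sum_freshProb_le (hm : 1 ≤ m) (hk : 1 ≤ k) (n : ℕ) {L : ℝ} (hL : 0 < L) :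
    ∑ s ∈ Finset.range n, freshProb m (s + 2 * k) ≤
      Real.exp (1 / (4 * m)) * (1 + L⁻¹ * Real.exp ((1 + L) * (4 * k + L) / (4 * m))) *
        gaussianTail (1 / (4 * m)) (2 * k - 1) := by
  have hm0 : (0 : ℝ) < m := by positivity
  have hb : (0 : ℝ) < 1 / (4 * m) := by positivity
  have hk' : (1 : ℝ) ≤ k := by exact_mod_cast hk
  set b : ℝ := 1 / (4 * m) with hbdef
  have hx0 : (0 : ℝ) ≤ 2 * k - 2 := by linarith
  have h1 : ∑ s ∈ Finset.range n, freshProb m (s + 2 * k) ≤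
      Real.exp b * ∑ s ∈ Finset.range n, Real.exp (-b * (2 * k - 2 + (s + 1 : ℕ)) ^ 2) := by
    rw [Finset.mul_sum]
    refine Finset.sum_le_sum fun s _ => (freshProb_le hm _).trans_eq ?_
    rw [← hbdef]
    push_cast
    congr 4
    ring
  have h2 : ∑ s ∈ Finset.range n, Real.exp (-b * (2 * k - 2 + (s + 1 : ℕ)) ^ 2) ≤
      ∫ u in (2 * k - 2 : ℝ)..(2 * k - 2 + n), Real.exp (-b * u ^ 2) :=
    AntitoneOn.sum_le_integral (f := fun u => Real.exp (-b * u ^ 2))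
      ((antitoneOn_exp_neg_mul_sq hb).mono fun u hu => hx0.trans hu.1)
  have h3 := integral_add_gaussianTail hb (2 * k - 2) (2 * k - 2 + n)
  have h4 := gaussianTail_nonneg b (2 * k - 2 + n)
  have h5 := integral_add_gaussianTail hb (2 * k - 2) (2 * k - 1)
  have h6 := integral_exp_neg_mul_sq_le hb hx0 (by linarith : (2 * k - 2 : ℝ) ≤ 2 * k - 1)
  have h7 := le_gaussianTail hb (by linarith : (0 : ℝ) ≤ 2 * k - 1) hL.le
  -- The exponent comes from `(2k - 1 + L)² - (2k - 2)² = (1 + L)(4k - 3 + L)`.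
  have h8 : Real.exp (-b * (2 * k - 2) ^ 2) ≤ L⁻¹ * Real.exp ((1 + L) * (4 * k + L) / (4 * m)) *
      gaussianTail b (2 * k - 1) := by
    calc Real.exp (-b * (2 * k - 2) ^ 2)
        ≤ Real.exp ((1 + L) * (4 * k + L) / (4 * m) + -b * (2 * k - 1 + L) ^ 2) := by
          refine Real.exp_le_exp.2 ?_
          rw [div_eq_mul_one_div, ← hbdef]
          nlinarith [mul_nonneg hb.le (by linarith : 0 ≤ 1 + L)]
      _ = L⁻¹ * Real.exp ((1 + L) * (4 * k + L) / (4 * m)) *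
          (L * Real.exp (-b * (2 * k - 1 + L) ^ 2)) := by
          rw [Real.exp_add]
          field_simp
      _ ≤ _ := by gcongr
  refine h1.trans ?_
  rw [mul_assoc]
  gcongr
  rw [add_mul, one_mul]
  linarith

/-- Keep only the first `N` terms, where `le_freshProb` applies with `T = 2 * k + N`; the discarded
tail is an `exp (-N² / (4m))` fraction by `gaussianTail_add_le`. -/
theorem le_sum_freshProb (hm : 1 ≤ m) (hk : 1 ≤ k) {N : ℕ} (hN : 2 * k + N ≤ m) :
    Real.exp (-((2 * k + N : ℕ) : ℝ) ^ 3 / m ^ 2) * (1 - Real.exp (-(N : ℝ) ^ 2 / (4 * m))) *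
        gaussianTail (1 / (4 * m)) (2 * k - 1) ≤
      ∑ s ∈ Finset.range (2 * m + 1), freshProb m (s + 2 * k) := by
  have hm0 : (0 : ℝ) < m := by positivity
  have hb : (0 : ℝ) < 1 / (4 * m) := by positivity
  have hk' : (1 : ℝ) ≤ k := by exact_mod_cast hk
  set b : ℝ := 1 / (4 * m) with hbdef
  have hx0 : (0 : ℝ) ≤ 2 * k - 1 := by linarith
  have h1 : ∑ s ∈ Finset.range N, freshProb m (s + 2 * k) ≤
      ∑ s ∈ Finset.range (2 * m + 1), freshProb m (s + 2 * k) :=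
    Finset.sum_le_sum_of_subset_of_nonneg (Finset.range_subset_range.2 (by omega))
      fun _ _ _ => freshProb_nonneg hm _
  have h2 : Real.exp (-((2 * k + N : ℕ) : ℝ) ^ 3 / m ^ 2) *
      ∑ s ∈ Finset.range N, Real.exp (-b * (2 * k - 1 + s) ^ 2) ≤
      ∑ s ∈ Finset.range N, freshProb m (s + 2 * k) := by
    rw [Finset.mul_sum]
    refine Finset.sum_le_sum fun s hs => ?_
    have hs' := Finset.mem_range.1 hs
    refine le_trans (le_of_eq ?_) (le_freshProb hm (by omega : s + 2 * k ≤ 2 * k + N) hN)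
    rw [← hbdef, neg_div]
    push_cast
    congr 4
    ring
  have h3 : (∫ u in (2 * k - 1 : ℝ)..(2 * k - 1 + N), Real.exp (-b * u ^ 2)) ≤
      ∑ s ∈ Finset.range N, Real.exp (-b * (2 * k - 1 + s) ^ 2) :=
    AntitoneOn.integral_le_sum (f := fun u => Real.exp (-b * u ^ 2))
      ((antitoneOn_exp_neg_mul_sq hb).mono fun u hu => hx0.trans hu.1)
  have h4 := integral_add_gaussianTail hb (2 * k - 1) (2 * k - 1 + N)
  have h5 := gaussianTail_add_le hb hx0 (Nat.cast_nonneg (α := ℝ) N)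
  refine le_trans ?_ (h2.trans h1)
  rw [mul_assoc]
  gcongr
  rw [show -(N : ℝ) ^ 2 / (4 * m) = -b * (N : ℝ) ^ 2 by rw [hbdef]; ring, sub_mul, one_mul]
  linarith

end FreshProb

/-! ### Asymptotics as the number of actions grows -/

section Limits

variable {k : ℕ → ℕ}

theorem tendsto_natCast_rpow_neg {p : ℝ} (hp : 0 < p) :
    Tendsto (fun m : ℕ => (m : ℝ) ^ (-p)) atTop (𝓝 0) :=
  (tendsto_rpow_neg_atTop hp).comp tendsto_natCast_atTop_atTop

/-- This is the choice `L = m^{1/3}` in `sum_freshProb_le`: the cross term `L k / m` is exactly `k /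
m^{2/3}`, while `1 / L` still vanishes. -/
theorem tendsto_exponent_upper
    (h : Tendsto (fun m : ℕ => (k m : ℝ) / (m : ℝ) ^ (2 / 3 : ℝ)) atTop (𝓝 0)) :
    Tendsto (fun m : ℕ => (1 + (m : ℝ) ^ (1 / 3 : ℝ)) * (4 * k m + (m : ℝ) ^ (1 / 3 : ℝ)) /
      (4 * m)) atTop (𝓝 0) := by
  have ha := tendsto_natCast_rpow_neg (p := 1 / 3) (by norm_num)
  have hlim := ((ha.add_const 1).mul ((h.const_mul 4).add ha)).div_const 4
  norm_num only at hlim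
  refine hlim.congr' ?_
  filter_upwards [eventually_ge_atTop 1] with m hm
  have hm0 : (0 : ℝ) < m := by positivity
  have e1 : (m : ℝ) ^ (2 / 3 : ℝ) = ((m : ℝ) ^ (1 / 3 : ℝ)) ^ 2 := by
    rw [← Real.rpow_mul_natCast hm0.le]
    norm_num
  have e2 : (m : ℝ) = ((m : ℝ) ^ (1 / 3 : ℝ)) ^ 3 := by
    rw [← Real.rpow_mul_natCast hm0.le]
    norm_num
  have e3 : (m : ℝ) ^ (-(1 / 3) : ℝ) = ((m : ℝ) ^ (1 / 3 : ℝ))⁻¹ := Real.rpow_neg hm0.le _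
  have hpos : 0 < (m : ℝ) ^ (1 / 3 : ℝ) := Real.rpow_pos_of_pos hm0 _
  rw [e1, e3]
  set a := (m : ℝ) ^ (1 / 3 : ℝ)
  rw [e2]
  field_simp

/-- The length of the window of times that carries almost all of the probability. -/
noncomputable def window (m : ℕ) : ℕ := ⌈(m : ℝ) ^ (3 / 5 : ℝ)⌉₊

/-- The exponent `3/5` lies strictly between `1/2` and `2/3`: small enough here for the cubic error
to vanish, large enough for the truncated Gaussian tail to be negligible (`tendsto_window_sq_div`).
-/
theorem tendsto_window_div :
    Tendsto (fun m : ℕ => (window m : ℝ) / (m : ℝ) ^ (2 / 3 : ℝ)) atTop (𝓝 0) := by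
  have h1 := tendsto_natCast_rpow_neg (p := 1 / 15) (by norm_num)
  have h2 := tendsto_natCast_rpow_neg (p := 2 / 3) (by norm_num)
  have h12 := h1.add h2
  rw [add_zero] at h12
  refine squeeze_zero' (Eventually.of_forall fun m => by positivity) ?_ h12
  filter_upwards [eventually_ge_atTop 1] with m hm
  have hm0 : (0 : ℝ) < m := by positivity
  rw [div_le_iff₀ (Real.rpow_pos_of_pos hm0 _), add_mul, ← Real.rpow_add hm0,
    ← Real.rpow_add hm0]
  norm_num only
  rw [Real.rpow_zero]
  exact (Nat.ceil_lt_add_one (by positivity)).le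

theorem tendsto_window_sq_div :
    Tendsto (fun m : ℕ => (window m : ℝ) ^ 2 / (4 * m)) atTop atTop := by
  have h : Tendsto (fun m : ℕ => (m : ℝ) ^ (1 / 5 : ℝ) / 4) atTop atTop :=
    ((tendsto_rpow_atTop (by norm_num)).comp tendsto_natCast_atTop_atTop).atTop_div_const
      (by norm_num)
  refine tendsto_atTop_mono' _ ?_ h
  filter_upwards [eventually_ge_atTop 1] with m hm
  have hm0 : (0 : ℝ) < m := by positivity
  rw [div_le_div_iff₀ (by norm_num) (by positivity)]
  have e : (m : ℝ) ^ (1 / 5 : ℝ) * m = ((m : ℝ) ^ (3 / 5 : ℝ)) ^ 2 := by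
    rw [← Real.rpow_mul_natCast hm0.le]
    nth_rewrite 2 [← Real.rpow_one (m : ℝ)]
    rw [← Real.rpow_add hm0]
    norm_num
  have hle : ((m : ℝ) ^ (3 / 5 : ℝ)) ^ 2 ≤ (window m : ℝ) ^ 2 :=
    pow_le_pow_left₀ (by positivity) (Nat.le_ceil _) 2
  linarith

theorem tendsto_horizon_div
    (h : Tendsto (fun m : ℕ => (k m : ℝ) / (m : ℝ) ^ (2 / 3 : ℝ)) atTop (𝓝 0)) :
    Tendsto (fun m : ℕ => ((2 * k m + window m : ℕ) : ℝ) / (m : ℝ) ^ (2 / 3 : ℝ)) atTop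
      (𝓝 0) := by
  have := (h.const_mul 2).add tendsto_window_div
  rw [mul_zero, add_zero] at this
  refine this.congr fun m => ?_
  push_cast
  ring

theorem eventually_horizon_le
    (h : Tendsto (fun m : ℕ => (k m : ℝ) / (m : ℝ) ^ (2 / 3 : ℝ)) atTop (𝓝 0)) :
    ∀ᶠ m in atTop, 2 * k m + window m ≤ m := by
  filter_upwards [(tendsto_horizon_div h).eventually_le_const one_pos, eventually_ge_atTop 1]
    with m hle hm
  have hm1 : (1 : ℝ) ≤ m := by exact_mod_cast hm
  rw [div_le_one (Real.rpow_pos_of_pos (by linarith) _)] at hle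
  have h1 : (m : ℝ) ^ (2 / 3 : ℝ) ≤ m :=
    (Real.rpow_le_rpow_of_exponent_le hm1 (by norm_num)).trans_eq (Real.rpow_one _)
  exact_mod_cast hle.trans h1

theorem tendsto_horizon_cube_div
    (h : Tendsto (fun m : ℕ => (k m : ℝ) / (m : ℝ) ^ (2 / 3 : ℝ)) atTop (𝓝 0)) :
    Tendsto (fun m : ℕ => ((2 * k m + window m : ℕ) : ℝ) ^ 3 / (m : ℝ) ^ 2) atTop (𝓝 0) := by
  have := (tendsto_horizon_div h).pow 3
  rw [zero_pow (by norm_num)] at this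
  refine this.congr fun m => ?_
  rw [div_pow, ← Real.rpow_mul_natCast (Nat.cast_nonneg m)]
  norm_num

theorem tendsto_sum_freshProb_div_gaussianTail (hk : ∀ᶠ m in atTop, 1 ≤ k m)
    (h : Tendsto (fun m : ℕ => (k m : ℝ) / (m : ℝ) ^ (2 / 3 : ℝ)) atTop (𝓝 0)) :
    Tendsto (fun m : ℕ => (∑ s ∈ Finset.range (2 * m + 1), freshProb m (s + 2 * k m)) /
      gaussianTail (1 / (4 * m)) (2 * k m - 1)) atTop (𝓝 1) := by
  have hinv : Tendsto (fun m : ℕ => 1 / (4 * (m : ℝ))) atTop (𝓝 0) :=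
    tendsto_const_nhds.div_atTop (tendsto_natCast_atTop_atTop.const_mul_atTop (by norm_num))
  have hL : Tendsto (fun m : ℕ => ((m : ℝ) ^ (1 / 3 : ℝ))⁻¹) atTop (𝓝 0) :=
    ((tendsto_rpow_atTop (by norm_num)).comp tendsto_natCast_atTop_atTop).inv_tendsto_atTop
  have hup := hinv.rexp.mul ((hL.mul (tendsto_exponent_upper h).rexp).const_add 1)
  have hlow := (tendsto_horizon_cube_div h).neg.rexp.mul
    ((Real.tendsto_exp_neg_atTop_nhds_zero.comp tendsto_window_sq_div).const_sub 1)
  norm_num only [Real.exp_zero] at hup hlow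
  refine tendsto_of_tendsto_of_tendsto_of_le_of_le' hlow hup ?_ ?_
  · filter_upwards [hk, eventually_horizon_le h] with m hkm hN
    have hm : 1 ≤ m := by omega
    have hk' : (1 : ℝ) ≤ k m := by exact_mod_cast hkm
    rw [le_div_iff₀ (gaussianTail_pos (by positivity) (by linarith)), Function.comp_apply,
      ← neg_div, ← neg_div]
    exact le_sum_freshProb hm hkm hN
  · filter_upwards [hk, eventually_ge_atTop 1] with m hkm hm
    have hk' : (1 : ℝ) ≤ k m := by exact_mod_cast hkm
    rw [div_le_iff₀ (gaussianTail_pos (by positivity) (by linarith))]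
    exact sum_freshProb_le hm hkm _ (Real.rpow_pos_of_pos (by positivity) _)

variable (P : Measure ℝ) [IsProbabilityMeasure P] [NullSingletonClass P]

theorem sqrt_pi_div_eq {m : ℝ} (hm : 0 < m) :
    Real.sqrt (Real.pi / m) = Real.sqrt (Real.pi * m) / m := by
  rw [show Real.pi / m = Real.pi * m / m ^ 2 by field_simp, Real.sqrt_div' _ (by positivity),
    Real.sqrt_sq hm.le]

theorem tendsto_probCycle_div_gaussianTail (hk : ∀ᶠ m in atTop, 1 ≤ k m)
    (h : Tendsto (fun m : ℕ => (k m : ℝ) / (m : ℝ) ^ (2 / 3 : ℝ)) atTop (𝓝 0)) :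
    Tendsto (fun m : ℕ => probCycle P m (k m) /
      (gaussianTail (1 / (4 * m)) (2 * k m - 1) / m)) atTop (𝓝 1) := by
  refine (tendsto_sum_freshProb_div_gaussianTail hk h).congr' ?_
  filter_upwards [hk, eventually_ge_atTop 1] with m hkm hm
  rw [probCycle_eq P hm hkm, div_div_div_cancel_right₀ (by positivity)]

theorem tendsto_probCycle_div_stdNormalCDF (hk : ∀ᶠ m in atTop, 1 ≤ k m)
    (h : (fun m : ℕ => (k m : ℝ)) =o[atTop] (fun m : ℕ => (m : ℝ) ^ (2 / 3 : ℝ))) :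
    Tendsto (fun m : ℕ => probCycle P m (k m) / (2 * Real.sqrt (Real.pi / m) *
      (1 - stdNormalCDF ((2 * (k m : ℝ) - 1) / Real.sqrt (2 * m))))) atTop (𝓝 1) := by
  refine (tendsto_probCycle_div_gaussianTail P hk h.tendsto_div_nhds_zero).congr' ?_
  filter_upwards [eventually_ge_atTop 1] with m hm
  have hm0 : (0 : ℝ) < m := by positivity
  rw [gaussianTail_eq_stdNormalCDF hm0, sqrt_pi_div_eq hm0]
  congr 1
  ring

/-- The integrand is at most `1`, so moving the start from `0` to `2k - 1` loses at most `2k - 1 =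
o(√m)` out of `√(πm)`. -/
theorem tendsto_gaussianTail_div (hk : ∀ᶠ m in atTop, 1 ≤ k m)
    (h : Tendsto (fun m : ℕ => (k m : ℝ) / Real.sqrt m) atTop (𝓝 0)) :
    Tendsto (fun m : ℕ => gaussianTail (1 / (4 * m)) (2 * k m - 1) / Real.sqrt (Real.pi * m))
      atTop (𝓝 1) := by
  have hlow := (h.const_mul (2 / Real.sqrt Real.pi)).const_sub 1
  rw [mul_zero, sub_zero] at hlow
  refine tendsto_of_tendsto_of_tendsto_of_le_of_le' hlow tendsto_const_nhds ?_ ?_ <;>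
    filter_upwards [hk, eventually_ge_atTop 1] with m hkm hm
  all_goals
    have hm0 : (0 : ℝ) < m := by positivity
    have hb : (0 : ℝ) < 1 / (4 * m) := by positivity
    have hk' : (1 : ℝ) ≤ k m := by exact_mod_cast hkm
    have hpm : 0 < Real.sqrt (Real.pi * m) := Real.sqrt_pos.2 (by positivity)
    have h1 := integral_add_gaussianTail hb 0 (2 * k m - 1)
    rw [gaussianTail_zero hm0] at h1
  · have h2 := integral_exp_neg_mul_sq_le hb le_rfl (by linarith : (0 : ℝ) ≤ 2 * k m - 1)
    rw [sq, mul_zero, mul_zero, Real.exp_zero] at h2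
    rw [le_div_iff₀ hpm, sub_mul, Real.sqrt_mul Real.pi_pos.le]
    rw [Real.sqrt_mul Real.pi_pos.le] at h1
    have hs1 : 0 < Real.sqrt Real.pi := Real.sqrt_pos.2 Real.pi_pos
    have hs2 : 0 < Real.sqrt m := Real.sqrt_pos.2 hm0
    have e : 2 / Real.sqrt Real.pi * (k m / Real.sqrt m) * (Real.sqrt Real.pi * Real.sqrt m) =
        2 * k m := by
      field_simp
    rw [e]
    linarith
  · rw [div_le_one hpm]
    have h2 := le_integral_exp_neg_mul_sq hb le_rfl (by linarith : (0 : ℝ) ≤ 2 * k m - 1)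
    have h3 : 0 ≤ (2 * k m - 1 - 0 : ℝ) * Real.exp (-(1 / (4 * m)) * (2 * k m - 1 : ℝ) ^ 2) :=
      mul_nonneg (by linarith) (Real.exp_pos _).le
    linarith

theorem tendsto_probCycle_div_sqrt (hk : ∀ᶠ m in atTop, 1 ≤ k m)
    (h : (fun m : ℕ => (k m : ℝ)) =o[atTop] (fun m : ℕ => Real.sqrt (m : ℝ))) :
    Tendsto (fun m : ℕ => probCycle P m (k m) / Real.sqrt (Real.pi / m)) atTop (𝓝 1) := by
  have hO : (fun m : ℕ => Real.sqrt (m : ℝ)) =O[atTop] (fun m : ℕ => (m : ℝ) ^ (2 / 3 : ℝ)) := by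
    refine IsBigO.of_bound 1 ?_
    filter_upwards [eventually_ge_atTop 1] with m hm
    rw [one_mul, Real.sqrt_eq_rpow, Real.norm_of_nonneg (by positivity),
      Real.norm_of_nonneg (by positivity)]
    exact Real.rpow_le_rpow_of_exponent_le (by exact_mod_cast hm) (by norm_num)
  have hlim := (tendsto_probCycle_div_gaussianTail P hk
    (h.trans_isBigO hO).tendsto_div_nhds_zero).mul
      (tendsto_gaussianTail_div hk h.tendsto_div_nhds_zero)
  rw [one_mul] at hlim
  refine hlim.congr' ?_
  filter_upwards [hk, eventually_ge_atTop 1] with m hkm hm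
  have hm0 : (0 : ℝ) < m := by positivity
  have hk' : (1 : ℝ) ≤ k m := by exact_mod_cast hkm
  have hG : gaussianTail (1 / (4 * m)) (2 * k m - 1) ≠ 0 :=
    (gaussianTail_pos (by positivity) (by linarith)).ne'
  have hpm : Real.sqrt (Real.pi * m) ≠ 0 := (Real.sqrt_pos.2 (by positivity)).ne'
  rw [sqrt_pi_div_eq hm0]
  field_simp

theorem tendsto_probPureNash_div_sqrt :
    Tendsto (fun m : ℕ => probPureNash P m / Real.sqrt (Real.pi / m)) atTop (𝓝 1) := by
  simp only [probPureNash_eq]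
  refine tendsto_probCycle_div_sqrt P (k := fun _ => 1) (Eventually.of_forall fun _ => le_rfl) ?_
  refine isLittleO_const_left.2 (Or.inr ?_)
  refine tendsto_norm_atTop_atTop.comp ?_
  exact Real.tendsto_sqrt_atTop.comp tendsto_natCast_atTop_atTop

end Limits

end BestResponse

theorem proposition3 (P : Measure ℝ) [IsProbabilityMeasure P] [NullSingletonClass P] :
    (∀ k : ℕ → ℕ, (∀ᶠ m in atTop, 1 ≤ k m) →
      (fun m : ℕ => (k m : ℝ)) =o[atTop] (fun m : ℕ => (m : ℝ) ^ (2 / 3 : ℝ)) →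
      Tendsto (fun m : ℕ => BestResponse.probCycle P m (k m) /
          (2 * Real.sqrt (Real.pi / m) *
            (1 - BestResponse.stdNormalCDF ((2 * (k m : ℝ) - 1) / Real.sqrt (2 * m)))))
        atTop (𝓝 1)) ∧
    (∀ k : ℕ → ℕ, (∀ᶠ m in atTop, 1 ≤ k m) →
      (fun m : ℕ => (k m : ℝ)) =o[atTop] (fun m : ℕ => Real.sqrt (m : ℝ)) →
      Tendsto (fun m : ℕ => BestResponse.probCycle P m (k m) / Real.sqrt (Real.pi / m))
        atTop (𝓝 1)) ∧
    Tendsto (fun m : ℕ => BestResponse.probPureNash P m / Real.sqrt (Real.pi / m))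
      atTop (𝓝 1) := by
  exact ⟨fun _ hk h => BestResponse.tendsto_probCycle_div_stdNormalCDF P hk h,
    fun _ hk h => BestResponse.tendsto_probCycle_div_sqrt P hk h,
    BestResponse.tendsto_probPureNash_div_sqrt P⟩
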